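/- **Setting.** Let $k\ge 2$ and let $G$ be a $k$-cube group with $k$-cube structure $(A_1,\dots,A_k)$, that is, the group of a one-vertex $k$-cube complex $P$ whose oriented edges of colour $i$ are labelled by $A_i$. This means: $A_1,\dots,A_k\subseteq G$ are finite; inversion is a fixed point free involution of each $A_i$; $\bigcup_i A_i$ generates $G$; for $i\ne j$, $A_iA_j=A_jA_i$ has $\#A_i\cdot\#A_j$ elements and contains no element of order $2$; and $G$ acts, without interchanging the factors, simply transitively on the vertices of a product $T_1\times\dots\times T_k$ of trees, $A_i$ being the set of elements that move a base vertex $x_0$ to one of its neighbours in direction $i$. The squares of $P$ are given by the relations $ab=b'a'$ in $G$ with $a,a'\in A_i$, $b,b'\in A_j$, $i\neq j$. Let $H$ be a normal subgroup of $G$ of finite index $N$, and let $Q:G\to S_N$ be the composition of $G\to G/H$ with the Cayley embedding $G/H\to S_N$ (left multiplication, for a numbering of $G/H$ by $1,\dots,N$). Let $\mathcal X$ be the $N$-vertex cover of $P$ with vertices $1,\dots,N$, with an edge $a^n$ of colour $i$ from $n$ to $Q(a)(n)$ for each $a\in A_i$ and each $n$, the reversal of $a^n$ being $(a^{-1})^{Q(a)(n)}$,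 and with, for each square $ab=b'a'$ of $P$ and each $n$, a square with sides $(a')^n,(b')^s$ from $n$ to $m$ via $s$ and $b^n,a^r$ from $n$ to $m$ via $r$, where $s=Q(a')(n)$, $r=Q(b)(n)$, $m=Q(b')(s)=Q(a)(r)$. A *$k$-dimensional digraph* is a finite directed graph with edge set $E=E_1\sqcup\dots\sqcup E_k$ together with a bijection $\phi$ of the set $Y$ of directed paths of length two with edges of distinct colours such that, writing $xy\sim y'x'$ for $\phi(xy)=y'x'$: (F1) $\phi$ preserves origin and terminus, interchanges the two colours, and $\phi^2=1$; (F2) if $xyz$ is a path with edges of three distinct colours and $xy\sim y^1x^1$, $x^1z\sim z^1x^2$, $y^1z^1\sim z^2y^2$, $yz\sim z_1y_1$, $xz_1\sim z_2x_1$, $x_1y_1\sim y_2x_2$, then $x_2=x^2$, $y_2=y^2$, $z_2=z^2$. It is *right rigid* if for all $x\in E_i$, $y\in E_j$, $i\ne j$, with the same origin there are unique $x'\in E_i$, $y'\in E_j$ with $xy'\sim yx'$, and *left rigid* if for all $x'\in E_i$, $y'\in E_j$, $i\neq j$, with the same terminus there are unique $x\in E_i$, $y\in E_j$ with $xy'\sim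 yx'$. Let $\operatorname{DG}(\mathcal X)$ be the directed graph with the vertices of $\mathcal X$ and with two directed edges, of opposite orientations and the same colour, for each geometric edge of $\mathcal X$, with $\phi(xy)=y'x'$ if and only if $xy$ and $y'x'$ are the two paths with the same ends along the boundary of a square $(x,y,x'^{-1},y'^{-1})$ of $\mathcal X$. Let $\Lambda(\mathcal X)$ be the quotient of the free category on this directed graph by the congruence generated by $xy\sim\phi(xy)$, with the degree map $d:\Lambda(\mathcal X)\to\mathbb N^k$ that counts the edges of each colour. A *$k$-graph* is a countable small category with a degree map $d$ to $\mathbb N^k$ such that $d(\mu\nu)=d(\mu)+d(\nu)$ and such that each $\pi$ with $d(\pi)=m+n$ factors uniquely as $\pi=\mu\nu$ with $d(\mu)=m$, $d(\nu)=n$. It is *finite* if it has finitely many objects and finitely many morphisms of each degree $e_i$; a finite $k$-graph is *strongly connected* if there is a morphism from any object to any object. It is *right rigid* if for $i\ne j$ and morphisms $x$, $y$ of degrees $e_i$, $e_j$ with the same origin there are unique $x'$, $y'$ of degrees $e_i$, $e_j$ with $y'\circ x=x'\circ y$, and *left rigid* if for $i\ne j$ and $x'$, $y'$ of degrees $e_i$,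 $e_j$ with the same terminus there are unique such $x$, $y$. **Theorem 4.7.** (a) $\operatorname{DG}(\mathcal X)$ is a $k$-dimensional digraph, and it is left and right rigid. (b) $\Lambda(\mathcal X)$ is a finite $k$-graph; it is strongly connected, left rigid and right rigid. -/

import Mathlib

open CategoryTheory
open scoped Pointwise

universe u v w

set_option linter.checkUnivs false

/-! ## Groups acting simply transitively on products of trees -/

/-- `IsCubeStructure A`: the `k`-tuple `(A 0, …, A (k - 1))` of subsets of the group `G` is a
`k`-cube structure, i.e. `G` is the `k`-cube group of the one-vertex `k`-cube complex
`P = P_(A 0, …, A (k - 1))` whose oriented edges of colour `i` are labelled by `A i`. -/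
structure IsCubeStructure {G : Type u} [Group G] {k : ℕ} (A : Fin k → Set G) : Prop where
  /-- The sets are finite. -/
  finite : ∀ i, (A i).Finite
  /-- Taking inverses is an involution of each `A i`. -/
  inv_mem : ∀ i, ∀ a ∈ A i, a⁻¹ ∈ A i
  /-- Taking inverses has no fixed point in `A i`. -/
  inv_ne : ∀ i, ∀ a ∈ A i, a⁻¹ ≠ a
  /-- The union of the `A i` generates `G`. -/
  closure_eq : Subgroup.closure (⋃ i, A i) = ⊤
  /-- The product sets have the maximal possible size. -/
  card_mul : ∀ i j, i ≠ j → (A i * A j).ncard = (A i).ncard * (A j).ncard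
  /-- The product sets commute. -/
  mul_comm : ∀ i j, i ≠ j → A i * A j = A j * A i
  /-- The product sets contain no element of order two. -/
  no_two_torsion : ∀ i j, i ≠ j → ∀ g ∈ A i * A j, orderOf g ≠ 2
  /-- `G` acts, without interchanging the factors, simply transitively on (the vertices of) a
  Cartesian product of `k` trees, and `A i` is the set of elements which move a base vertex `x₀`
  of the product along an edge in direction `i`; in other words, the product of trees is the
  universal cover of the one-vertex complex `P`, with the `A i` as labels of its edges. -/
  trees : ∃ (T : Fin k → Type u) (Γ : ∀ i, SimpleGraph (T i)) (_ : ∀ i, MulAction G (T i))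
      (x₀ : ∀ i, T i),
    (∀ i, (Γ i).IsTree) ∧
    (∀ i (g : G) (x y : T i), (Γ i).Adj (g • x) (g • y) ↔ (Γ i).Adj x y) ∧
    (∀ x y : ∀ i, T i, ∃! g : G, ∀ i, g • x i = y i) ∧
    (∀ i (g : G), g ∈ A i ↔ (Γ i).Adj (x₀ i) (g • x₀ i) ∧ ∀ j, j ≠ i → g • x₀ j = x₀ j)

/-! ## Coloured square complexes: the 2-skeleta of cube complexes -/

/-- A square complex with edges of `k` colours: a graph with oriented edges `E`, orientation
reversal `inv` without fixed points, and squares.  A (geometric) square is a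
closed path of four oriented edges, up to the dihedral action generated by cyclic permutation and
reversal; `Square e₁ e₂ e₃ e₄` says that `(e₁, e₂, e₃, e₄)` represents a square of the complex.
This is the part of a `k`-cube complex on which its digraph depends. -/
structure SquareComplex (k : ℕ) where
  /-- vertices -/
  V : Type v
  /-- oriented edges -/
  E : Type u
  /-- origin -/
  o : E → V
  /-- terminus -/
  t : E → V
  /-- orientation reversal -/
  inv : E → E
  /-- colour, i.e. direction, of an edge -/
  colour : E → Fin k
  inv_inv : ∀ e, inv (inv e) = e
  inv_ne : ∀ e, inv e ≠ e
  o_inv : ∀ e, o (inv e) = t e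
  colour_inv : ∀ e, colour (inv e) = colour e
  /-- representatives of the squares -/
  Square : E → E → E → E → Prop
  square_closed : ∀ {e₁ e₂ e₃ e₄}, Square e₁ e₂ e₃ e₄ →
    t e₁ = o e₂ ∧ t e₂ = o e₃ ∧ t e₃ = o e₄ ∧ t e₄ = o e₁
  square_colour : ∀ {e₁ e₂ e₃ e₄}, Square e₁ e₂ e₃ e₄ →
    colour e₁ ≠ colour e₂ ∧ colour e₃ = colour e₁ ∧ colour e₄ = colour e₂
  square_rotate : ∀ {e₁ e₂ e₃ e₄}, Square e₁ e₂ e₃ e₄ → Square e₂ e₃ e₄ e₁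
  square_reverse : ∀ {e₁ e₂ e₃ e₄}, Square e₁ e₂ e₃ e₄ →
    Square (inv e₄) (inv e₃) (inv e₂) (inv e₁)

/-! ## The `N`-vertex complex of a permutation representation -/

/-- The homomorphism `Q : G → S_N`: the quotient map `G → G ⧸ H` followed by the embedding of
`G ⧸ H` into `S_N` of Cayley's theorem, i.e. by left multiplication, where `e` numbers the `N`
elements of `G ⧸ H`. -/
def cayleyHom {G : Type u} [Group G] (H : Subgroup G) [H.Normal] {N : ℕ} (e : G ⧸ H ≃ Fin N) :
    G →* Equiv.Perm (Fin N) :=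
  (e.permCongrHom.toMonoidHom.comp (MulAction.toPermHom (G ⧸ H) (G ⧸ H))).comp
    (QuotientGroup.mk' H)

/-- The oriented edges `aⁿ` of the `N`-vertex complex, with `a ∈ A i` for a colour `i` and with
`n ∈ {1, …, N}`. -/
@[ext]
structure CoverEdge {G : Type u} {k : ℕ} (A : Fin k → Set G) (N : ℕ) where
  /-- the colour `i` -/
  colour : Fin k
  /-- the label `a` -/
  label : G
  label_mem : label ∈ A colour
  /-- the upper index `n` -/
  source : Fin N

namespace CoverEdge

variable {G : Type u} [Group G] {k : ℕ} {A : Fin k → Set G} {N : ℕ}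

/-- The edge `aⁿ` ends in the vertex `Q(a)(n)`. -/
def target (Q : G →* Equiv.Perm (Fin N)) (x : CoverEdge A N) : Fin N := Q x.label x.source

/-- The reversal of the edge `aⁿ` from `n` to `n' = Q(a)(n)` is the edge labelled by `a⁻¹` from
`n'` to `n`. -/
def reverse (hA : IsCubeStructure A) (Q : G →* Equiv.Perm (Fin N)) (x : CoverEdge A N) :
    CoverEdge A N where
  colour := x.colour
  label := x.label⁻¹
  label_mem := hA.inv_mem _ _ x.label_mem
  source := x.target Q

end CoverEdge

/-- The squares of the `N`-vertex complex.  Each square of the one-vertex complex `P`, that is,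
each relation `a b = b' a'` in `G` with `a, a' ∈ A i`, `b, b' ∈ A j`, `i ≠ j`, gives for each `n`
the square with the sides `(a')ⁿ`, `(b')ˢ` from `n` to `m` via `s` and `bⁿ`, `aʳ` from `n` to `m`
via `r`, where `s = Q(a')(n)`, `r = Q(b)(n)` and `m = Q(b')(s) = Q(a)(r)`. -/
inductive CoverSquare {G : Type u} [Group G] {k : ℕ} {A : Fin k → Set G} {N : ℕ}
    (hA : IsCubeStructure A) (Q : G →* Equiv.Perm (Fin N)) :
    CoverEdge A N → CoverEdge A N → CoverEdge A N → CoverEdge A N → Prop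
  | lift {i j : Fin k} (hij : i ≠ j) {a a' b b' : G} (ha : a ∈ A i) (ha' : a' ∈ A i)
      (hb : b ∈ A j) (hb' : b' ∈ A j) (h : a * b = b' * a') (n : Fin N) :
      CoverSquare hA Q ⟨i, a', ha', n⟩ ⟨j, b', hb', Q a' n⟩
        (CoverEdge.reverse hA Q ⟨i, a, ha, Q b n⟩) (CoverEdge.reverse hA Q ⟨j, b, hb, n⟩)
  | rotate {x₁ x₂ x₃ x₄ : CoverEdge A N} : CoverSquare hA Q x₁ x₂ x₃ x₄ →
      CoverSquare hA Q x₂ x₃ x₄ x₁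
  | reverse {x₁ x₂ x₃ x₄ : CoverEdge A N} : CoverSquare hA Q x₁ x₂ x₃ x₄ →
      CoverSquare hA Q (x₄.reverse hA Q) (x₃.reverse hA Q) (x₂.reverse hA Q) (x₁.reverse hA Q)

section

variable {G : Type u} [Group G] {k : ℕ} {A : Fin k → Set G} {N : ℕ}
  (hA : IsCubeStructure A) (Q : G →* Equiv.Perm (Fin N))

theorem CoverEdge.target_reverse (x : CoverEdge A N) :
    (x.reverse hA Q).target Q = x.source := by
  simp [CoverEdge.reverse, CoverEdge.target]

theorem CoverEdge.reverse_reverse (x : CoverEdge A N) :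
    (x.reverse hA Q).reverse hA Q = x := by
  ext <;> simp [CoverEdge.reverse, CoverEdge.target]

theorem CoverSquare.closed {hA : IsCubeStructure A} {Q : G →* Equiv.Perm (Fin N)}
    {x₁ x₂ x₃ x₄ : CoverEdge A N}
    (h : CoverSquare hA Q x₁ x₂ x₃ x₄) : x₁.target Q = x₂.source ∧ x₂.target Q = x₃.source ∧
      x₃.target Q = x₄.source ∧ x₄.target Q = x₁.source := by
  induction h with
  | lift hij ha ha' hb hb' h n =>
    have := congrArg (fun g => Q g n) h
    simp only [map_mul, Equiv.Perm.mul_apply] at this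
    refine ⟨rfl, this.symm, ?_, ?_⟩
    · exact CoverEdge.target_reverse hA Q _
    · exact CoverEdge.target_reverse hA Q _
  | rotate _ ih => exact ⟨ih.2.1, ih.2.2.1, ih.2.2.2, ih.1⟩
  | reverse _ ih =>
    simp only [CoverEdge.target_reverse]
    exact ⟨ih.2.2.1.symm, ih.2.1.symm, ih.1.symm, ih.2.2.2.symm⟩

theorem CoverSquare.colours {hA : IsCubeStructure A} {Q : G →* Equiv.Perm (Fin N)}
    {x₁ x₂ x₃ x₄ : CoverEdge A N}
    (h : CoverSquare hA Q x₁ x₂ x₃ x₄) : x₁.colour ≠ x₂.colour ∧ x₃.colour = x₁.colour ∧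
      x₄.colour = x₂.colour := by
  induction h with
  | lift hij => exact ⟨hij, rfl, rfl⟩
  | rotate _ ih => exact ⟨by rw [ih.2.1]; exact ih.1.symm, ih.2.2, ih.2.1.symm⟩
  | reverse _ ih =>
    simp only [CoverEdge.reverse]
    exact ⟨by rw [ih.2.1, ih.2.2]; exact ih.1.symm, ih.2.2.symm, ih.2.1.symm⟩

/-- The complex `𝒳` with vertices `1, …, N`, edges `aⁿ` from `n` to `Q(a)(n)`, and the `N` lifts of
each square of the one-vertex complex `P` as squares. -/
def coverComplex : SquareComplex.{u, 0} k where
  V := Fin N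
  E := CoverEdge A N
  o := CoverEdge.source
  t := CoverEdge.target Q
  inv := CoverEdge.reverse hA Q
  colour := CoverEdge.colour
  inv_inv := CoverEdge.reverse_reverse hA Q
  inv_ne x h := hA.inv_ne _ _ x.label_mem (congrArg CoverEdge.label h)
  o_inv _ := rfl
  colour_inv _ := rfl
  Square := CoverSquare hA Q
  square_closed h := h.closed
  square_colour h := h.colours
  square_rotate h := h.rotate
  square_reverse h := h.reverse

end

/-! ## `k`-dimensional digraphs -/

/-- A directed graph whose edges have one of `k` colours. -/
structure ColouredGraph (k : ℕ) where
  /-- vertices -/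
  V : Type v
  /-- directed edges -/
  E : Type u
  /-- origin -/
  o : E → V
  /-- terminus -/
  t : E → V
  /-- colour -/
  colour : E → Fin k

/-- The set `Y` of directed paths `xy` of length two with edges `x`, `y` of distinct colours. -/
@[ext]
structure BiPath {k : ℕ} (Γ : ColouredGraph.{u, v} k) where
  /-- the first edge -/
  fst : Γ.E
  /-- the second edge -/
  snd : Γ.E
  comp : Γ.t fst = Γ.o snd
  ne : Γ.colour fst ≠ Γ.colour snd

/-- `xy ∼ y'x'` for a map `φ` on the set of bicoloured paths of length two: `xy` and `y'x'` are
such paths, and `φ(xy) = y'x'`. -/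
def BiPath.Sim {k : ℕ} {Γ : ColouredGraph.{u, v} k} (φ : BiPath Γ → BiPath Γ)
    (x y y' x' : Γ.E) : Prop :=
  ∃ p : BiPath Γ, p.fst = x ∧ p.snd = y ∧ (φ p).fst = y' ∧ (φ p).snd = x'

/-- The structure of a `k`-dimensional digraph on a directed graph with coloured edges. -/
structure KDigraph {k : ℕ} (Γ : ColouredGraph.{u, v} k) where
  finite_vertices : Finite Γ.V
  finite_edges : Finite Γ.E
  /-- the bijection `φ : Y → Y` -/
  φ : BiPath Γ ≃ BiPath Γ
  /-- `φ` exchanges the two colours, -/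
  colour_fst : ∀ p, Γ.colour (φ p).fst = Γ.colour p.snd
  colour_snd : ∀ p, Γ.colour (φ p).snd = Γ.colour p.fst
  /-- keeps the origin and the terminus, -/
  origin : ∀ p, Γ.o (φ p).fst = Γ.o p.fst
  terminus : ∀ p, Γ.t (φ p).snd = Γ.t p.snd
  /-- and is an involution. -/
  involutive : ∀ p, φ (φ p) = p
  /-- The cube condition, with `xᵢ` written `xi` and `xⁱ` written `xi'`. -/
  cube : ∀ {x y z x1 x2 x1' x2' y1 y2 y1' y2' z1 z2 z1' z2' : Γ.E},
    Γ.colour x ≠ Γ.colour y → Γ.colour x ≠ Γ.colour z → Γ.colour y ≠ Γ.colour z →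
    BiPath.Sim φ x y y1' x1' → BiPath.Sim φ x1' z z1' x2' → BiPath.Sim φ y1' z1' z2' y2' →
    BiPath.Sim φ y z z1 y1 → BiPath.Sim φ x z1 z2 x1 → BiPath.Sim φ x1 y1 y2 x2 →
    x2 = x2' ∧ y2 = y2' ∧ z2 = z2'

namespace KDigraph

variable {k : ℕ} {Γ : ColouredGraph.{u, v} k} (D : KDigraph Γ)

/-- `xy ∼ y'x'` -/
def Sim (x y y' x' : Γ.E) : Prop := BiPath.Sim D.φ x y y' x'

/-- Edges `x`, `y` of distinct colours with the same origin are the initial edges of a unique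
square `xy' ∼ yx'`. -/
def RightRigid : Prop :=
  ∀ x y : Γ.E, Γ.colour x ≠ Γ.colour y → Γ.o x = Γ.o y →
    ∃! p : Γ.E × Γ.E, Γ.colour p.1 = Γ.colour x ∧ Γ.colour p.2 = Γ.colour y ∧
      D.Sim x p.2 y p.1

/-- Edges `x'`, `y'` of distinct colours with the same terminus are the final edges of a unique
square `xy' ∼ yx'`. -/
def LeftRigid : Prop :=
  ∀ x' y' : Γ.E, Γ.colour x' ≠ Γ.colour y' → Γ.t x' = Γ.t y' →
    ∃! p : Γ.E × Γ.E, Γ.colour p.1 = Γ.colour x' ∧ Γ.colour p.2 = Γ.colour y' ∧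
      D.Sim p.1 y' p.2 x'

end KDigraph

/-- The coloured directed graph underlying `DG(X)`: the vertices are those of the complex `X`, and
each geometric edge of `X` gives two directed edges, of the same colour and opposite orientation,
i.e. the directed edges are the oriented edges of `X`. -/
def SquareComplex.graph {k : ℕ} (X : SquareComplex.{u, v} k) : ColouredGraph.{u, v} k where
  V := X.V
  E := X.E
  o := X.o
  t := X.t
  colour := X.colour

/-- `D` is the `k`-dimensional digraph `DG(X)` of the complex `X`: `φ(xy) = y'x'` if and only if
`xy` and `y'x'` are the two pairs of consecutive edges, with common origin and common
terminus, in a square `(x, y, x'⁻¹, y'⁻¹)` of `X`.  (This determines `D`.) -/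
def SquareComplex.IsDG {k : ℕ} (X : SquareComplex.{u, v} k) (D : KDigraph X.graph) : Prop :=
  ∀ p q : BiPath X.graph,
    D.φ p = q ↔ X.Square p.fst p.snd (X.inv q.snd) (X.inv q.fst)

/-! ## `k`-graphs -/

section KGraph

variable {k : ℕ} {C : Type v} [Category.{w} C] (d : ∀ ⦃a b : C⦄, (a ⟶ b) → (Fin k → ℕ))

/-- A small category `C` with a degree map `d` to `ℕᵏ` is a `k`-graph.  The composition `μν` of the
factorisation property is `μ ∘ ν = ν ≫ μ`. -/
structure IsKGraph : Prop where
  countable_obj : Countable C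
  countable_hom : ∀ a b : C, Countable (a ⟶ b)
  degree_id : ∀ a : C, d (𝟙 a) = 0
  degree_comp : ∀ {a b c : C} (ν : a ⟶ b) (μ : b ⟶ c), d (ν ≫ μ) = d μ + d ν
  factorisation : ∀ {a c : C} (π : a ⟶ c) (m n : Fin k → ℕ), d π = m + n →
    ∃! p : Σ b : C, (a ⟶ b) × (b ⟶ c), p.2.1 ≫ p.2.2 = π ∧ d p.2.2 = m ∧ d p.2.1 = n

/-- A `k`-graph is finite if it has finitely many vertices and finitely many edges of each degree
`eᵢ`. -/
def IsFiniteKGraph : Prop :=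
  Finite C ∧ ∀ i : Fin k, Finite {f : Σ a b : C, (a ⟶ b) // d f.2.2 = Pi.single i 1}

/-- A finite `k`-graph is strongly connected if there is a morphism from any vertex to any vertex. -/
def IsStronglyConnectedKGraph : Prop :=
  IsFiniteKGraph d ∧ ∀ a b : C, Nonempty (a ⟶ b)

/-- Edges `x`, `y` of distinct degrees `eᵢ`, `eⱼ` with the same origin are the initial edges of a
unique commutative square `y' ∘ x = x' ∘ y`, with `x'` of degree `eᵢ` and `y'` of degree `eⱼ`. -/
def IsRightRigidKGraph : Prop :=
  ∀ i j : Fin k, i ≠ j → ∀ {a b c : C} (x : a ⟶ b) (y : a ⟶ c),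
    d x = Pi.single i 1 → d y = Pi.single j 1 →
    ∃! p : Σ e : C, (c ⟶ e) × (b ⟶ e),
      d p.2.1 = Pi.single i 1 ∧ d p.2.2 = Pi.single j 1 ∧ x ≫ p.2.2 = y ≫ p.2.1

/-- Edges `x'`, `y'` of distinct degrees `eᵢ`, `eⱼ` with the same terminus are the final edges of a
unique commutative square `y' ∘ x = x' ∘ y`, with `x` of degree `eᵢ` and `y` of degree `eⱼ`. -/
def IsLeftRigidKGraph : Prop :=
  ∀ i j : Fin k, i ≠ j → ∀ {b c e : C} (x' : c ⟶ e) (y' : b ⟶ e),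
    d x' = Pi.single i 1 → d y' = Pi.single j 1 →
    ∃! p : Σ a : C, (a ⟶ b) × (a ⟶ c),
      d p.2.1 = Pi.single i 1 ∧ d p.2.2 = Pi.single j 1 ∧ p.2.1 ≫ y' = p.2.2 ≫ x'

end KGraph

/-! ## The category of a `k`-dimensional digraph -/

/-- The vertices of a coloured directed graph, as a quiver. -/
def ColouredGraph.Vertex {k : ℕ} (Γ : ColouredGraph.{u, v} k) : Type v := Γ.V

instance {k : ℕ} (Γ : ColouredGraph.{u, v} k) : Quiver.{u} Γ.Vertex where
  Hom a b := {e : Γ.E // Γ.o e = a ∧ Γ.t e = b}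

/-- The degree of a path: the number of its edges of each colour. -/
def ColouredGraph.pathDegree {k : ℕ} (Γ : ColouredGraph.{u, v} k) {a : Γ.Vertex} :
    ∀ {b : Γ.Vertex}, Quiver.Path a b → (Fin k → ℕ)
  | _, Quiver.Path.nil => 0
  | _, Quiver.Path.cons p e => pathDegree Γ p + Pi.single (Γ.colour e.1) 1

theorem ColouredGraph.pathDegree_comp {k : ℕ} (Γ : ColouredGraph.{u, v} k) {a b c : Γ.Vertex}
    (p : Quiver.Path a b) (q : Quiver.Path b c) :
    Γ.pathDegree (p.comp q) = Γ.pathDegree p + Γ.pathDegree q := by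
  induction q with
  | nil => simp [pathDegree]
  | cons q e ih => simp [pathDegree, ih, add_assoc]

/-- The degree of an arrow of the free category on the graph. -/
def ColouredGraph.arrowDegree {k : ℕ} (Γ : ColouredGraph.{u, v} k) {a b : Paths Γ.Vertex}
    (p : a ⟶ b) : Fin k → ℕ :=
  Γ.pathDegree (a := a) (b := b) p

theorem ColouredGraph.arrowDegree_comp {k : ℕ} (Γ : ColouredGraph.{u, v} k)
    {a b c : Paths Γ.Vertex} (p : a ⟶ b) (q : b ⟶ c) :
    Γ.arrowDegree (p ≫ q) = Γ.arrowDegree p + Γ.arrowDegree q :=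
  Γ.pathDegree_comp (a := a) (b := b) (c := c) p q

namespace KDigraph

variable {k : ℕ} {Γ : ColouredGraph.{u, v} k} (D : KDigraph Γ)

/-- Diverting a path `xy` of length two to `y'x' = φ(xy)`. -/
inductive Divert : HomRel (Paths Γ.Vertex)
  | mk {a b b' c : Γ.Vertex} (x : a ⟶ b) (y : b ⟶ c) (y' : a ⟶ b') (x' : b' ⟶ c)
      (h : D.Sim x.1 y.1 y'.1 x'.1) : Divert (x.toPath.comp y.toPath) (y'.toPath.comp x'.toPath)

/-- The category `Λ_DG`: the quotient of the free (path) category on the directed graph by the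
congruence generated by diverting over `φ`. -/
abbrev Lambda : Type v := CategoryTheory.Quotient D.Divert

theorem pathDegree_eq_of_divert {a b : Paths Γ.Vertex} {p q : a ⟶ b}
    (h : HomRel.CompClosure D.Divert p q) : Γ.arrowDegree p = Γ.arrowDegree q := by
  obtain ⟨c, e, f, m₁, m₂, g, h⟩ := h
  have key : Γ.arrowDegree m₁ = Γ.arrowDegree m₂ := by
    obtain ⟨x, y, y', x', r, hx, hy, hy', hx'⟩ := h
    have h1 := D.colour_fst r
    have h2 := D.colour_snd r
    rw [hy', hy] at h1
    rw [hx', hx] at h2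
    change 0 + Pi.single (Γ.colour x.1) 1 + Pi.single (Γ.colour y.1) 1 =
      0 + Pi.single (Γ.colour y'.1) 1 + Pi.single (Γ.colour x'.1) 1
    rw [h1, h2, zero_add, zero_add, add_comm]
  simp only [ColouredGraph.arrowDegree_comp, key]

/-- The degree map of `Λ_DG`. -/
def degree ⦃a b : D.Lambda⦄ (f : a ⟶ b) : Fin k → ℕ :=
  Quot.lift (fun p : a.as ⟶ b.as => Γ.arrowDegree p) (fun _ _ h => D.pathDegree_eq_of_divert h) f

end KDigraph

/-! Two facts about the action on the product of trees carry the proof: elements of `A i` fix every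
coordinate of the base point except the `i`-th, and the base point has trivial stabiliser. Hence an
element of a product of sets `A i` with distinct colours determines its factors (`mul_inj`,
`mul_mul_inj`). Since `Q` is a left action, a path `xy` in the cover has label `y.label * x.label`,
and a square says that two bicoloured paths with the same origin have the same label. Existence of
`φ` and of the rigidity completions comes from `A i * A j = A j * A i`; their uniqueness, and the
cube condition, come from unique factorisation of labels.

In `Λ`, factorisations exist because diversions can move an edge of any colour that occurs in a path
to its end. Uniqueness does not go through the cube condition but through an invariant: lift a path
to the product of trees so that it ends at the base point, and record in each tree the vertices met
when walking back (`trace`). Diversions do not change this record (`label_trace_eq_of_ofPath_eq`),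
and together with the terminus it determines the morphism (`ofPath_eq_of_trace_eq`). Cutting the
record at the length prescribed by a degree separates the two factors.

Strong connectivity holds because the `A i` generate `G` and `G` acts transitively on `G ⧸ H`. -/

/-! ### Unique factorisation in a cube group -/

namespace IsCubeStructure

variable {G : Type u} [Group G] {k : ℕ} {A : Fin k → Set G}

/-- A base point of the product of trees: elements of `A i` move only its `i`-th coordinate, and
its stabiliser is trivial. -/
theorem exists_base (hA : IsCubeStructure A) :
    ∃ (T : Fin k → Type u) (_ : ∀ i, MulAction G (T i)) (x₀ : ∀ i, T i),
      (∀ i, ∀ a ∈ A i, ∀ j, j ≠ i → a • x₀ j = x₀ j) ∧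
      (∀ g h : G, (∀ i, g • x₀ i = h • x₀ i) → g = h) := by
  obtain ⟨T, Γ, act, x₀, -, -, hst, hmem⟩ := hA.trees
  refine ⟨T, act, x₀, fun i a ha => ((hmem i a).1 ha).2, fun g h hgh => ?_⟩
  exact (hst x₀ (fun i => h • x₀ i)).unique hgh (fun _ => rfl)

/-- On the other coordinates both elements fix the base point, so they agree on all of it and
freeness applies. -/
theorem eq_of_smul_base_eq {T : Fin k → Type u} [∀ i, MulAction G (T i)] {x₀ : ∀ i, T i}
    (hfix : ∀ i, ∀ a ∈ A i, ∀ j, j ≠ i → a • x₀ j = x₀ j)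
    (hfree : ∀ g h : G, (∀ i, g • x₀ i = h • x₀ i) → g = h) {i : Fin k} {a a' : G}
    (ha : a ∈ A i) (ha' : a' ∈ A i) (h : a • x₀ i = a' • x₀ i) : a = a' := by
  refine hfree _ _ fun j => ?_
  by_cases hj : j = i
  · subst hj; exact h
  · rw [hfix i a ha j hj, hfix i a' ha' j hj]

theorem exists_swap (hA : IsCubeStructure A) {i j : Fin k} (hij : i ≠ j) {a b : G} (ha : a ∈ A i)
    (hb : b ∈ A j) : ∃ b' ∈ A j, ∃ a' ∈ A i, b' * a' = a * b := by
  have h : a * b ∈ A j * A i := hA.mul_comm i j hij ▸ Set.mul_mem_mul ha hb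
  exact Set.mem_mul.1 h

/-- On the `i`-th coordinate of the base point the factors of colours `j` and `l` act trivially, so
the product there shows only its first factor. Cancel it and repeat with `j`. -/
theorem mul_mul_inj (hA : IsCubeStructure A) {i j l : Fin k} (hij : i ≠ j) (hil : i ≠ l)
    (hjl : j ≠ l) {a a' b b' c c' : G} (ha : a ∈ A i) (ha' : a' ∈ A i) (hb : b ∈ A j)
    (hb' : b' ∈ A j) (hc : c ∈ A l) (hc' : c' ∈ A l) (h : a * b * c = a' * b' * c') :
    a = a' ∧ b = b' ∧ c = c' := by
  obtain ⟨T, _, x₀, hfix, hfree⟩ := hA.exists_base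
  have h1 : a = a' := by
    refine eq_of_smul_base_eq hfix hfree ha ha' ?_
    have := congrArg (· • x₀ i) h
    simpa only [mul_smul, hfix l c hc i hil, hfix l c' hc' i hil, hfix j b hb i hij,
      hfix j b' hb' i hij] using this
  subst h1
  have h2 : b * c = b' * c' := by simpa only [mul_assoc, mul_right_inj] using h
  have h3 : b = b' := by
    refine eq_of_smul_base_eq hfix hfree hb hb' ?_
    have := congrArg (· • x₀ j) h2
    simpa only [mul_smul, hfix l c hc j hjl, hfix l c' hc' j hjl] using this
  subst h3
  exact ⟨rfl, rfl, by simpa using h2⟩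

theorem mul_inj (hA : IsCubeStructure A) {i j : Fin k} (hij : i ≠ j)
    {a a' b b' : G} (ha : a ∈ A i) (ha' : a' ∈ A i) (hb : b ∈ A j)
    (hb' : b' ∈ A j) (h : a * b = a' * b') : a = a' ∧ b = b' := by
  obtain ⟨T, _, x₀, hfix, hfree⟩ := hA.exists_base
  have h1 : a = a' := by
    refine eq_of_smul_base_eq hfix hfree ha ha' ?_
    have := congrArg (· • x₀ i) h
    simpa only [mul_smul, hfix j b hb i hij, hfix j b' hb' i hij] using this
  subst h1
  exact ⟨rfl, by simpa using h⟩

end IsCubeStructure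

/-! ### The digraph of the cover: squares, cube condition, rigidity -/

section Cover

variable {G : Type u} [Group G] {k : ℕ} {A : Fin k → Set G} {N : ℕ}
  {hA : IsCubeStructure A} {Q : G →* Equiv.Perm (Fin N)}

/-- Rotating a square conjugates the boundary label and reversing it inverts the label, so
triviality passes from the lifted relations to all representatives. -/
theorem CoverSquare.label_mul {x₁ x₂ x₃ x₄ : CoverEdge A N} (h : CoverSquare hA Q x₁ x₂ x₃ x₄) :
    x₄.label * x₃.label * x₂.label * x₁.label = 1 := by
  induction h with
  | lift hij ha ha' hb hb' h n =>
    simp only [CoverEdge.reverse]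
    rw [mul_assoc _ _ (_ : G), ← h]
    group
  | @rotate x₁ x₂ x₃ x₄ _ ih =>
    have := eq_inv_of_mul_eq_one_left ih
    rw [mul_assoc, mul_assoc, ← mul_assoc x₄.label, this, mul_inv_cancel]
  | @reverse x₁ x₂ x₃ x₄ _ ih =>
    simp only [CoverEdge.reverse, ← mul_inv_rev, inv_eq_one, ← mul_assoc]
    exact ih

variable (hA Q) in
/-- The squares of the cover, as pairs of paths `xy` and `y'x'` with the same ends. -/
theorem coverSquare_iff {x y y' x' : CoverEdge A N} (hxy : x.colour ≠ y.colour)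
    (hc : x.target Q = y.source) (hc' : y'.target Q = x'.source) :
    CoverSquare hA Q x y (x'.reverse hA Q) (y'.reverse hA Q) ↔
      x'.colour = x.colour ∧ y'.colour = y.colour ∧ y'.source = x.source ∧
        x'.label * y'.label = y.label * x.label := by
  constructor
  · intro h
    obtain ⟨-, h1, h2⟩ := h.colours
    obtain ⟨-, -, -, h3⟩ := h.closed
    rw [CoverEdge.target_reverse] at h3
    refine ⟨h1, h2, h3, ?_⟩
    have := h.label_mul
    simp only [CoverEdge.reverse, ← mul_inv_rev, mul_assoc] at this
    exact (inv_mul_eq_one.1 this)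
  · rintro ⟨h1, h2, h3, h4⟩
    obtain ⟨i, a', ha', n⟩ := x
    obtain ⟨j, b', hb', s⟩ := y
    obtain ⟨j', b, hb, n'⟩ := y'
    obtain ⟨i', a, ha, r⟩ := x'
    dsimp only [CoverEdge.target] at *
    subst h1 h2 h3 hc hc'
    exact CoverSquare.lift hxy ha ha' hb hb' h4 _

variable (hA Q) in
/-- The bicoloured path `xy` has exactly one complement `y'x'`. -/
theorem exists_swapped (p : BiPath (coverComplex hA Q).graph) :
    ∃ q : BiPath (coverComplex hA Q).graph, CoverEdge.colour q.snd = CoverEdge.colour p.fst ∧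
      CoverEdge.colour q.fst = CoverEdge.colour p.snd ∧
      CoverEdge.source q.fst = CoverEdge.source p.fst ∧
      CoverEdge.label q.snd * CoverEdge.label q.fst =
        CoverEdge.label p.snd * CoverEdge.label p.fst := by
  obtain ⟨⟨i, a, ha, n⟩, ⟨j, b, hb, s⟩, hc, hne⟩ := p
  obtain ⟨a', ha', b', hb', h⟩ := hA.exists_swap (Ne.symm hne) hb ha
  exact ⟨⟨⟨j, b', hb', n⟩, ⟨i, a', ha', Q b' n⟩, rfl, Ne.symm hne⟩, rfl, rfl, rfl, h⟩

theorem BiPath.ext_of_label {p q : BiPath (coverComplex hA Q).graph}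
    (h1 : CoverEdge.colour p.fst = CoverEdge.colour q.fst)
    (h2 : CoverEdge.colour p.snd = CoverEdge.colour q.snd)
    (h3 : CoverEdge.source p.fst = CoverEdge.source q.fst)
    (h4 : CoverEdge.label p.snd * CoverEdge.label p.fst =
      CoverEdge.label q.snd * CoverEdge.label q.fst) : p = q := by
  obtain ⟨⟨i, a, ha, n⟩, ⟨j, b, hb, s⟩, hc, hne⟩ := p
  obtain ⟨⟨i', a', ha', n'⟩, ⟨j', b', hb', s'⟩, hc', hne'⟩ := q
  dsimp only at h1 h2 h3 h4
  change Q a n = s at hc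
  change Q a' n' = s' at hc'
  subst h1 h2 h3
  obtain ⟨rfl, rfl⟩ := hA.mul_inj (Ne.symm hne) hb hb' ha ha' h4
  subst hc hc'
  rfl

variable (hA Q) in
/-- The complement `y'x'` of a bicoloured path `xy` in the cover. -/
noncomputable def swapBiPath (p : BiPath (coverComplex hA Q).graph) :
    BiPath (coverComplex hA Q).graph := (exists_swapped hA Q p).choose

/-- By `BiPath.ext_of_label` these conditions leave no freedom in the choice. They are symmetric in
`p` and `q`, which makes the swap an involution. -/
theorem swapBiPath_eq_iff {p q : BiPath (coverComplex hA Q).graph} :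
    swapBiPath hA Q p = q ↔ CoverEdge.colour q.snd = CoverEdge.colour p.fst ∧
      CoverEdge.colour q.fst = CoverEdge.colour p.snd ∧
      CoverEdge.source q.fst = CoverEdge.source p.fst ∧
      CoverEdge.label q.snd * CoverEdge.label q.fst =
        CoverEdge.label p.snd * CoverEdge.label p.fst := by
  have hs := (exists_swapped hA Q p).choose_spec
  change CoverEdge.colour (swapBiPath hA Q p).snd = _ ∧
    CoverEdge.colour (swapBiPath hA Q p).fst = _ ∧ CoverEdge.source (swapBiPath hA Q p).fst = _ ∧
    CoverEdge.label (swapBiPath hA Q p).snd * CoverEdge.label (swapBiPath hA Q p).fst = _ at hs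
  constructor
  · rintro rfl; exact hs
  · rintro ⟨h1, h2, h3, h4⟩
    exact BiPath.ext_of_label (hs.2.1.trans h2.symm) (hs.1.trans h1.symm)
      (hs.2.2.1.trans h3.symm) (hs.2.2.2.trans h4.symm)

theorem swapBiPath_swapBiPath (p : BiPath (coverComplex hA Q).graph) :
    swapBiPath hA Q (swapBiPath hA Q p) = p := by
  obtain ⟨h1, h2, h3, h4⟩ := swapBiPath_eq_iff.1 (rfl : swapBiPath hA Q p = _)
  exact swapBiPath_eq_iff.2 ⟨h2.symm, h1.symm, h3.symm, h4.symm⟩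

variable (Q) in
/-- `xy ∼ y'x'` in the digraph of the cover. -/
structure CoverSim (x y y' x' : CoverEdge A N) : Prop where
  ne : x.colour ≠ y.colour
  comp : x.target Q = y.source
  comp' : y'.target Q = x'.source
  colour_snd : x'.colour = x.colour
  colour_fst : y'.colour = y.colour
  origin : y'.source = x.source
  label : x'.label * y'.label = y.label * x.label

theorem sim_swapBiPath_iff {x y y' x' : CoverEdge A N} :
    BiPath.Sim (Γ := (coverComplex hA Q).graph) (swapBiPath hA Q) x y y' x' ↔
      CoverSim Q x y y' x' := by
  constructor
  · rintro ⟨p, rfl, rfl, rfl, rfl⟩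
    obtain ⟨h1, h2, h3, h4⟩ := swapBiPath_eq_iff.1 (rfl : swapBiPath hA Q p = _)
    exact ⟨p.ne, p.comp, (swapBiPath hA Q p).comp, h1, h2, h3, h4⟩
  · rintro ⟨h1, h2, h3, h4, h5, h6, h7⟩
    let q : BiPath (coverComplex hA Q).graph :=
      ⟨y', x', h3, fun h => h1 (h4.symm.trans (h.symm.trans h5))⟩
    have hq : swapBiPath hA Q ⟨x, y, h2, h1⟩ = q := swapBiPath_eq_iff.2 ⟨h4, h5, h6, h7⟩
    exact ⟨⟨x, y, h2, h1⟩, rfl, rfl, by rw [hq], by rw [hq]⟩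

theorem finite_coverEdge (hA : IsCubeStructure A) : Finite (CoverEdge A N) := by
  have := fun i => (hA.finite i).to_subtype
  refine Finite.of_injective (β := (Σ i, A i) × Fin N)
    (fun x => (⟨x.colour, x.label, x.label_mem⟩, x.source)) ?_
  rintro ⟨i, a, ha, n⟩ ⟨i', a', ha', n'⟩ h
  simp only [Prod.mk.injEq, Sigma.mk.injEq] at h
  obtain ⟨⟨rfl, h⟩, rfl⟩ := h
  simp only [heq_eq_eq, Subtype.mk.injEq] at h
  subst h
  rfl

theorem coverEdge_ext_of_target {x y : CoverEdge A N} (hc : x.colour = y.colour)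
    (hl : x.label = y.label) (ht : x.target Q = y.target Q) : x = y := by
  refine CoverEdge.ext hc hl ?_
  simp only [CoverEdge.target, hl] at ht
  exact (Q y.label).injective ht

theorem CoverSim.terminus {x y y' x' : CoverEdge A N} (h : CoverSim Q x y y' x') :
    x'.target Q = y.target Q := by
  rw [CoverEdge.target, CoverEdge.target, ← h.comp, ← h.comp', CoverEdge.target, CoverEdge.target,
    ← Equiv.Perm.mul_apply, ← Equiv.Perm.mul_apply, ← map_mul, ← map_mul, h.label, h.origin]

/-- Both ways around the cube refactor the label of the path `xyz` with its colours in reversed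
order, and such a factorisation is unique. -/
theorem CoverSim.cube (hA : IsCubeStructure A) {x y z x1 x2 x1' x2' y1 y2 y1' y2' z1 z2 z1' z2' : CoverEdge A N}
    (hxy : x.colour ≠ y.colour) (hxz : x.colour ≠ z.colour) (hyz : y.colour ≠ z.colour)
    (h1 : CoverSim Q x y y1' x1') (h2 : CoverSim Q x1' z z1' x2')
    (h3 : CoverSim Q y1' z1' z2' y2') (h4 : CoverSim Q y z z1 y1)
    (h5 : CoverSim Q x z1 z2 x1) (h6 : CoverSim Q x1 y1 y2 x2) :
    x2 = x2' ∧ y2 = y2' ∧ z2 = z2' := by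
  have cx : x2.colour = x.colour := h6.colour_snd.trans h5.colour_snd
  have cx' : x2'.colour = x.colour := h2.colour_snd.trans h1.colour_snd
  have cy : y2.colour = y.colour := h6.colour_fst.trans h4.colour_snd
  have cy' : y2'.colour = y.colour := h3.colour_snd.trans h1.colour_fst
  have cz : z2.colour = z.colour := h5.colour_fst.trans h4.colour_fst
  have cz' : z2'.colour = z.colour := h3.colour_fst.trans h2.colour_fst
  -- Both sides equal `z.label * y.label * x.label`.
  have e : x2.label * y2.label * z2.label = x2'.label * y2'.label * z2'.label := by
    rw [h6.label, mul_assoc, h5.label, ← mul_assoc, h4.label, mul_assoc, ← h1.label, ← mul_assoc,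
      ← h2.label, mul_assoc, ← h3.label, mul_assoc]
  obtain ⟨ex, ey, ez⟩ := hA.mul_mul_inj hxy hxz hyz (cx ▸ x2.label_mem) (cx' ▸ x2'.label_mem)
    (cy ▸ y2.label_mem) (cy' ▸ y2'.label_mem) (cz ▸ z2.label_mem) (cz' ▸ z2'.label_mem) e
  -- With labels matched, positions remain: the first edges share their origin, the second start
  -- where the first end, and the last share their terminus.
  have fz : z2 = z2' := CoverEdge.ext (cz.trans cz'.symm) ez
    (by rw [h5.origin, h3.origin, h1.origin])
  have fy : y2 = y2' := CoverEdge.ext (cy.trans cy'.symm) ey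
    (by rw [h6.origin, ← h5.comp', ← h3.comp', fz])
  refine ⟨coverEdge_ext_of_target (Q := Q) (cx.trans cx'.symm) ex ?_, fy, fz⟩
  rw [h6.terminus, h4.terminus, h2.terminus]

variable (hA Q) in
/-- The digraph of the cover. -/
noncomputable def coverDigraph : KDigraph (coverComplex hA Q).graph where
  finite_vertices := inferInstanceAs (Finite (Fin N))
  finite_edges := finite_coverEdge hA
  φ := ⟨swapBiPath hA Q, swapBiPath hA Q, swapBiPath_swapBiPath, swapBiPath_swapBiPath⟩
  colour_fst _ := (swapBiPath_eq_iff.1 rfl).2.1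
  colour_snd _ := (swapBiPath_eq_iff.1 rfl).1
  origin _ := (swapBiPath_eq_iff.1 rfl).2.2.1
  terminus p := (sim_swapBiPath_iff.1 ⟨p, rfl, rfl, rfl, rfl⟩).terminus
  involutive := swapBiPath_swapBiPath
  cube hxy hxz hyz h1 h2 h3 h4 h5 h6 := CoverSim.cube hA hxy hxz hyz (sim_swapBiPath_iff.1 h1)
    (sim_swapBiPath_iff.1 h2) (sim_swapBiPath_iff.1 h3) (sim_swapBiPath_iff.1 h4)
    (sim_swapBiPath_iff.1 h5) (sim_swapBiPath_iff.1 h6)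

theorem coverDigraph_isDG : (coverComplex hA Q).IsDG (coverDigraph hA Q) := fun p q =>
  swapBiPath_eq_iff.trans (coverSquare_iff hA Q p.ne p.comp q.comp).symm

theorem coverDigraph_sim_iff {x y y' x' : CoverEdge A N} :
    (coverDigraph hA Q).Sim x y y' x' ↔ CoverSim Q x y y' x' := sim_swapBiPath_iff

variable (Q) in
-- For labels `a`, `b` of `x`, `y`, the square relation `c * b = d * a` reads `c⁻¹ * d = b * a⁻¹`;
-- completing the square means refactoring `b * a⁻¹` with the colours exchanged.
theorem CoverSim.existsUnique_right (hA : IsCubeStructure A) {x y : CoverEdge A N} (hne : x.colour ≠ y.colour)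
    (ho : x.source = y.source) :
    ∃! p : CoverEdge A N × CoverEdge A N, p.1.colour = x.colour ∧ p.2.colour = y.colour ∧
      CoverSim Q x p.2 y p.1 := by
  obtain ⟨i, a, ha, n⟩ := x
  obtain ⟨j, b, hb, m⟩ := y
  dsimp only at hne ho
  subst ho
  obtain ⟨a', ha', b', hb', h⟩ := hA.exists_swap hne.symm hb (hA.inv_mem _ _ ha)
  refine ⟨(⟨i, a'⁻¹, hA.inv_mem _ _ ha', Q b n⟩, ⟨j, b', hb', Q a n⟩), ⟨rfl, rfl, hne, rfl, rfl,
    rfl, rfl, rfl, ?_⟩, ?_⟩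
  · rw [inv_mul_eq_iff_eq_mul, ← mul_assoc, h, inv_mul_cancel_right]
  · rintro ⟨⟨i', c, hc, s⟩, ⟨j', d, hd, r⟩⟩ ⟨h1, h2, h3⟩
    dsimp only at h1 h2
    subst h1 h2
    have e1 : Q a n = r := h3.comp
    have e2 : Q b n = s := h3.comp'
    have e3 : c * b = d * a := h3.label
    have e4 : c⁻¹ * d = a' * b' := by
      rw [h, eq_mul_inv_iff_mul_eq, mul_assoc, ← e3, inv_mul_cancel_left]
    obtain ⟨rfl, rfl⟩ := hA.mul_inj hne (hA.inv_mem _ _ hc) ha' hd hb' e4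
    subst e1 e2
    simp

variable (Q) in
-- Dually, `a' * d = b' * c` reads `c * d⁻¹ = b'⁻¹ * a'`, so `b'⁻¹ * a'` is refactored.
theorem CoverSim.existsUnique_left (hA : IsCubeStructure A) {x' y' : CoverEdge A N} (hne : x'.colour ≠ y'.colour)
    (ht : x'.target Q = y'.target Q) :
    ∃! p : CoverEdge A N × CoverEdge A N, p.1.colour = x'.colour ∧ p.2.colour = y'.colour ∧
      CoverSim Q p.1 y' p.2 x' := by
  obtain ⟨i, a', ha', n⟩ := x'
  obtain ⟨j, b', hb', m⟩ := y'
  dsimp only at hne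
  change Q a' n = Q b' m at ht
  obtain ⟨a, ha, b, hb, h⟩ := hA.exists_swap hne.symm (hA.inv_mem _ _ hb') ha'
  have h' : a' * b⁻¹ = b' * a := by
    rw [mul_inv_eq_iff_eq_mul, mul_assoc, h, mul_inv_cancel_left]
  refine ⟨(⟨i, a, ha, Q a⁻¹ m⟩, ⟨j, b⁻¹, hA.inv_mem _ _ hb, Q b n⟩), ⟨rfl, rfl, hne, ?_, ?_,
    rfl, rfl, ?_, h'⟩, ?_⟩
  · simp [CoverEdge.target]
  · simp [CoverEdge.target]
  -- The two new edges start at the same vertex: `b = a⁻¹ * b'⁻¹ * a'`, and `a'` at `n`, `b'` at `m`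
  -- lead to the same vertex.
  · change Q b n = Q a⁻¹ m
    have h2 : b = a⁻¹ * b'⁻¹ * a' := by rw [mul_assoc, ← h, inv_mul_cancel_left]
    rw [h2]
    simp [ht]
  · rintro ⟨⟨i', c, hc, s⟩, ⟨j', d, hd, r⟩⟩ ⟨h1, h2, h3⟩
    dsimp only at h1 h2
    subst h1 h2
    have e1 : Q c s = m := h3.comp
    have e2 : Q d r = n := h3.comp'
    have e3 : a' * d = b' * c := h3.label
    have e4 : c * d⁻¹ = a * b := by
      rw [h, mul_inv_eq_iff_eq_mul, mul_assoc, e3, inv_mul_cancel_left]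
    obtain ⟨rfl, rfl⟩ := hA.mul_inj hne hc ha (hA.inv_mem _ _ hd) hb e4
    subst e1 e2
    simp

theorem coverDigraph_rightRigid : (coverDigraph hA Q).RightRigid := by
  intro x y hne ho
  refine (existsUnique_congr fun p => ?_).2 (CoverSim.existsUnique_right Q hA hne ho)
  exact and_congr_right' (and_congr_right' coverDigraph_sim_iff)

theorem coverDigraph_leftRigid : (coverDigraph hA Q).LeftRigid := by
  intro x y hne ht
  refine (existsUnique_congr fun p => ?_).2 (CoverSim.existsUnique_left Q hA hne ht)
  exact and_congr_right' (and_congr_right' coverDigraph_sim_iff)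

end Cover

/-! ### The category of an arbitrary `k`-dimensional digraph -/

namespace KDigraph

variable {k : ℕ} {Γ : ColouredGraph.{u, v} k} (D : KDigraph Γ)

/-- The object of `Λ_DG` given by a vertex. -/
def obj (a : Γ.Vertex) : D.Lambda := ⟨a⟩

theorem obj_surjective (a : D.Lambda) : ∃ v : Γ.Vertex, D.obj v = a := ⟨a.as, rfl⟩

/-- The morphism of `Λ_DG` represented by a path. -/
def ofPath {a b : Γ.Vertex} (p : Quiver.Path a b) : D.obj a ⟶ D.obj b :=
  (CategoryTheory.Quotient.functor D.Divert).map (X := (a : Paths Γ.Vertex)) (Y := b) p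

theorem ofPath_comp {a b c : Γ.Vertex} (p : Quiver.Path a b) (q : Quiver.Path b c) :
    D.ofPath (p.comp q) = D.ofPath p ≫ D.ofPath q :=
  (CategoryTheory.Quotient.functor D.Divert).map_comp (X := (a : Paths Γ.Vertex)) (Y := b)
    (Z := c) p q

theorem ofPath_cons {a b c : Γ.Vertex} (p : Quiver.Path a b) (e : b ⟶ c) :
    D.ofPath (p.cons e) = D.ofPath p ≫ D.ofPath e.toPath := D.ofPath_comp p e.toPath

/-- Stated with the origin bundled, since paths compared from their common terminus are not known
beforehand to start at the same vertex. -/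
theorem ofPath_cons_congr {a a' b c : Γ.Vertex} {p : Quiver.Path a b} {q : Quiver.Path a' b}
    (h : (⟨a, D.ofPath p⟩ : Σ a, D.obj a ⟶ D.obj b) = ⟨a', D.ofPath q⟩) (e : b ⟶ c) :
    (⟨a, D.ofPath (p.cons e)⟩ : Σ a, D.obj a ⟶ D.obj c) = ⟨a', D.ofPath (q.cons e)⟩ := by
  rw [ofPath_cons, ofPath_cons]
  simp only [Sigma.mk.injEq] at h
  obtain ⟨rfl, h⟩ := h
  rw [eq_of_heq h]

theorem ofPath_nil (a : Γ.Vertex) : D.ofPath (.nil : Quiver.Path a a) = 𝟙 _ :=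
  (CategoryTheory.Quotient.functor D.Divert).map_id (a : Paths Γ.Vertex)

theorem ofPath_surjective {a b : Γ.Vertex} (f : D.obj a ⟶ D.obj b) :
    ∃ p : Quiver.Path a b, D.ofPath p = f :=
  Quot.exists_rep f

theorem degree_ofPath {a b : Γ.Vertex} (p : Quiver.Path a b) :
    D.degree (D.ofPath p) = Γ.pathDegree p := rfl

theorem degree_comp {a b c : D.Lambda} (f : a ⟶ b) (g : b ⟶ c) :
    D.degree (f ≫ g) = D.degree g + D.degree f := by
  obtain ⟨a, rfl⟩ := D.obj_surjective a
  obtain ⟨b, rfl⟩ := D.obj_surjective b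
  obtain ⟨c, rfl⟩ := D.obj_surjective c
  obtain ⟨p, rfl⟩ := D.ofPath_surjective f
  obtain ⟨q, rfl⟩ := D.ofPath_surjective g
  rw [← ofPath_comp, degree_ofPath, degree_ofPath, degree_ofPath, Γ.pathDegree_comp, add_comm]

theorem ofPath_eq_of_sim {a b b' c : Γ.Vertex} {x : a ⟶ b} {y : b ⟶ c} {y' : a ⟶ b'} {x' : b' ⟶ c}
    (h : D.Sim x.1 y.1 y'.1 x'.1) :
    D.ofPath x.toPath ≫ D.ofPath y.toPath = D.ofPath y'.toPath ≫ D.ofPath x'.toPath := by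
  rw [← ofPath_comp, ← ofPath_comp]
  exact CategoryTheory.Quotient.sound _ (Divert.mk x y y' x' h)

/-- A function of paths which is compatible with composition and diversion is defined on
`Λ_DG`. -/
theorem eq_of_ofPath_eq {β : Type*} (F : ∀ {a b : Γ.Vertex}, Quiver.Path a b → β)
    (hcomp : ∀ {a b c d : Γ.Vertex} (f : Quiver.Path a b) (p q : Quiver.Path b c)
      (g : Quiver.Path c d), F p = F q → F (f.comp (p.comp g)) = F (f.comp (q.comp g)))
    (hsim : ∀ {a b b' c : Γ.Vertex} (x : a ⟶ b) (y : b ⟶ c) (y' : a ⟶ b') (x' : b' ⟶ c),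
      D.Sim x.1 y.1 y'.1 x'.1 → F (x.toPath.comp y.toPath) = F (y'.toPath.comp x'.toPath))
    {a b : Γ.Vertex} {p q : Quiver.Path a b} (h : D.ofPath p = D.ofPath q) : F p = F q := by
  have key : ∀ p q : (show Paths Γ.Vertex from a) ⟶ b, HomRel.CompClosure D.Divert p q →
      F (a := a) (b := b) p = F (a := a) (b := b) q := by
    rintro _ _ ⟨c, e, f, m₁, m₂, g, h⟩
    refine hcomp (a := a) (b := c) (c := e) (d := b) f m₁ m₂ g ?_
    obtain ⟨x, y, y', x', h⟩ := h
    exact hsim x y y' x' h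
  exact congrArg (Quot.lift _ key) h

theorem exists_sim {a b c : Γ.Vertex} (x : a ⟶ b) (y : b ⟶ c) (h : Γ.colour x.1 ≠ Γ.colour y.1) :
    ∃ (b' : Γ.Vertex) (y' : a ⟶ b') (x' : b' ⟶ c), Γ.colour x'.1 = Γ.colour x.1 ∧
      D.Sim x.1 y.1 y'.1 x'.1 := by
  let p : BiPath Γ := ⟨x.1, y.1, x.2.2.trans y.2.1.symm, h⟩
  exact ⟨Γ.t (D.φ p).fst, ⟨(D.φ p).fst, (D.origin p).trans x.2.1, rfl⟩,
    ⟨(D.φ p).snd, (D.φ p).comp.symm, (D.terminus p).trans y.2.2⟩, D.colour_snd p,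
    p, rfl, rfl, rfl, rfl⟩

/-- Each path is equivalent to one with a last edge of any prescribed colour that it contains. -/
theorem exists_cons_of_pathDegree_ne_zero {a b : Γ.Vertex} (p : Quiver.Path a b) {i : Fin k}
    (hi : Γ.pathDegree p i ≠ 0) : ∃ (c : Γ.Vertex) (q : Quiver.Path a c) (e : c ⟶ b),
      Γ.colour e.1 = i ∧ D.ofPath p = D.ofPath (q.cons e) := by
  induction p with
  | nil => exact absurd rfl hi
  | @cons b c p f ih =>
    by_cases hf : Γ.colour f.1 = i
    · exact ⟨b, p, f, hf, rfl⟩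
    · have hp : Γ.pathDegree p i ≠ 0 := by
        simpa [ColouredGraph.pathDegree, Pi.single_apply, Ne.symm hf] using hi
      -- Bring an edge of colour `i` to the end of `p`, then swap it past `f`.
      obtain ⟨c, q, e, he, h⟩ := ih hp
      obtain ⟨b', f', e', he', hs⟩ := D.exists_sim e f (by rw [he]; exact Ne.symm hf)
      refine ⟨b', q.cons f', e', he'.trans he, ?_⟩
      rw [ofPath_cons, h, ofPath_cons, ofPath_cons, ofPath_cons, Category.assoc, Category.assoc,
        D.ofPath_eq_of_sim hs]

/-- Peel edges off the end, each of a colour still occurring in `m`; the induction is on the total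
degree of `m`, and the terminus varies with it. -/
theorem exists_factorisation {a b : Γ.Vertex} (p : Quiver.Path a b) (m n : Fin k → ℕ)
    (h : Γ.pathDegree p = m + n) : ∃ (c : Γ.Vertex) (p₁ : Quiver.Path a c) (p₂ : Quiver.Path c b),
      D.ofPath p₁ ≫ D.ofPath p₂ = D.ofPath p ∧ Γ.pathDegree p₂ = m ∧ Γ.pathDegree p₁ = n := by
  induction hM : ∑ i, m i generalizing m b with
  | zero =>
    have hm : m = 0 := by
      ext i
      exact Finset.sum_eq_zero_iff.1 hM i (Finset.mem_univ i)
    subst hm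
    exact ⟨b, p, .nil, by rw [ofPath_nil, Category.comp_id], rfl, by rw [h, zero_add]⟩
  | succ M ih =>
    obtain ⟨i, -, hi⟩ : ∃ i ∈ Finset.univ, m i ≠ 0 := by
      by_contra! hcon
      rw [Finset.sum_eq_zero hcon] at hM
      exact absurd hM (by simp)
    obtain ⟨m', rfl⟩ : ∃ m', m = m' + Pi.single i 1 := by
      refine ⟨m - Pi.single i 1, (tsub_add_cancel_of_le fun j => ?_).symm⟩
      by_cases hj : j = i
      · subst hj; simpa using Nat.one_le_iff_ne_zero.2 hi
      · simp [hj]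
    obtain ⟨c, q, e, he, hq⟩ := D.exists_cons_of_pathDegree_ne_zero p (i := i) (by
      rw [h]; simp)
    have hq' : Γ.pathDegree q = m' + n := by
      have := congrArg (fun f => D.degree f) hq
      simp only [degree_ofPath, h, ColouredGraph.pathDegree, he] at this
      rw [add_right_comm] at this
      exact (add_right_cancel this).symm
    obtain ⟨d, p₁, p₂, h1, h2, h3⟩ := ih q m' hq' (by
      simpa [Finset.sum_add_distrib] using hM)
    refine ⟨d, p₁, p₂.cons e, ?_, ?_, h3⟩
    · rw [hq, ofPath_cons, ofPath_cons, ← h1, Category.assoc]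
    · simp only [ColouredGraph.pathDegree, h2, he]

theorem exists_edge {a b : Γ.Vertex} {f : D.obj a ⟶ D.obj b} {i : Fin k}
    (hf : D.degree f = Pi.single i 1) :
    ∃ e : a ⟶ b, Γ.colour e.1 = i ∧ D.ofPath e.toPath = f := by
  obtain ⟨p, rfl⟩ := D.ofPath_surjective f
  have hp : Γ.pathDegree p = Pi.single i 1 := hf
  clear hf
  cases p with
  | nil => exact absurd (congrFun hp i) (by simp [ColouredGraph.pathDegree])
  | cons p e =>
    cases p with
    | nil =>
      refine ⟨e, ?_, rfl⟩
      by_contra hne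
      have := congrFun hp i
      simp [ColouredGraph.pathDegree, Ne.symm hne] at this
    | cons p e' =>
      -- The total degree is the number of edges, here at least two instead of one.
      have := congrArg (fun d => ∑ j, d j) hp
      simp [ColouredGraph.pathDegree, Finset.sum_add_distrib] at this

theorem degree_edge {a b : Γ.Vertex} (e : a ⟶ b) :
    D.degree (D.ofPath e.toPath) = Pi.single (Γ.colour e.1) 1 := zero_add _

/-- The sequence of edges of a path, last edge first. -/
def edges {a : Γ.Vertex} : ∀ {b : Γ.Vertex}, Quiver.Path a b → List Γ.E
  | _, .nil => []
  | _, .cons p e => e.1 :: edges p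

/-- Each edge determines its origin, so the intermediate vertices are recovered from the list. This
embeds the paths into lists over a finite set, whence countability. -/
theorem edges_injective {a b : Γ.Vertex} :
    Function.Injective (edges : Quiver.Path a b → List Γ.E) := by
  intro p q h
  induction p with
  | nil =>
    cases q with
    | nil => rfl
    | cons q e => simp [edges] at h
  | cons p e ih =>
    cases q with
    | nil => simp [edges] at h
    | cons q e' =>
      simp only [edges, List.cons.injEq] at h
      obtain ⟨x, rfl, rfl⟩ := e
      obtain ⟨y, hy, hy'⟩ := e'
      obtain ⟨rfl, h⟩ := h
      subst hy
      rw [ih h]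

theorem countable_hom (a b : D.Lambda) : Countable (a ⟶ b) := by
  obtain ⟨a, rfl⟩ := D.obj_surjective a
  obtain ⟨b, rfl⟩ := D.obj_surjective b
  have := D.finite_edges
  have : Countable (Quiver.Path a b) := edges_injective.countable
  exact Function.Surjective.countable (f := D.ofPath) D.ofPath_surjective

theorem isFiniteKGraph : IsFiniteKGraph D.degree := by
  have := D.finite_edges
  have := D.finite_vertices
  refine ⟨Finite.of_surjective (α := Γ.V) D.obj D.obj_surjective, fun i => ?_⟩
  have hdeg : ∀ e : {e : Γ.E // Γ.colour e = i}, D.degree (D.ofPath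
      (Quiver.Hom.toPath (V := Γ.Vertex) (a := Γ.o e.1) (b := Γ.t e.1) ⟨e.1, rfl, rfl⟩)) =
        Pi.single i 1 := by
    rintro ⟨x, rfl⟩
    exact D.degree_edge _
  refine Finite.of_surjective (α := {e : Γ.E // Γ.colour e = i})
    (fun e => ⟨⟨D.obj (Γ.o e.1), D.obj (Γ.t e.1), _⟩, hdeg e⟩) ?_
  rintro ⟨⟨a, b, f⟩, hf⟩
  obtain ⟨a, rfl⟩ := D.obj_surjective a
  obtain ⟨b, rfl⟩ := D.obj_surjective b
  obtain ⟨⟨x, rfl, rfl⟩, he, rfl⟩ := D.exists_edge hf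
  exact ⟨⟨x, he⟩, rfl⟩

end KDigraph

/-! ### The trace of a path in the trees -/

section Trace

variable {G : Type u} [Group G] {k : ℕ} {A : Fin k → Set G} {N : ℕ}
  {hA : IsCubeStructure A} {Q : G →* Equiv.Perm (Fin N)}

/-- The product of the labels of the edges of a path, in the order of composition. -/
def pathLabel {a : (coverComplex hA Q).graph.Vertex} :
    ∀ {b : (coverComplex hA Q).graph.Vertex}, Quiver.Path a b → G
  | _, .nil => 1
  | _, .cons p e => CoverEdge.label e.1 * pathLabel p

theorem pathLabel_comp {a b c : (coverComplex hA Q).graph.Vertex} (p : Quiver.Path a b)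
    (q : Quiver.Path b c) : pathLabel (p.comp q) = pathLabel q * pathLabel p := by
  induction q with
  | nil => simp [pathLabel]
  | cons q e ih => simp [pathLabel, ih, mul_assoc]

variable {T : Fin k → Type u} [∀ i, MulAction G (T i)] (x₀ : ∀ i, T i)

/-- The projection to the `i`-th tree of the lift to the product of trees of a path in the cover,
where the lift is traversed backwards from the base point. -/
def trace (i : Fin k) {a : (coverComplex hA Q).graph.Vertex} :
    ∀ {b : (coverComplex hA Q).graph.Vertex}, Quiver.Path a b → List (T i)
  | _, .nil => []
  | _, .cons p e => (if CoverEdge.colour e.1 = i then [CoverEdge.label e.1 • x₀ i] else []) ++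
      (trace i p).map (CoverEdge.label e.1 • ·)

/-- Walking back along `q` moves the base point by `pathLabel q`; the walk along `p` then continues
from the translated point. -/
theorem trace_comp (i : Fin k) {a b c : (coverComplex hA Q).graph.Vertex} (p : Quiver.Path a b)
    (q : Quiver.Path b c) :
    trace x₀ i (p.comp q) = trace x₀ i q ++ (trace x₀ i p).map (pathLabel q • ·) := by
  induction q with
  | nil => simp [pathLabel, trace]
  | cons q e ih =>
    simp only [Quiver.Path.comp_cons, trace, ih, pathLabel, List.map_append, List.append_assoc,
      List.map_map, Function.comp_def, mul_smul]

theorem length_trace (i : Fin k) {a b : (coverComplex hA Q).graph.Vertex} (p : Quiver.Path a b) :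
    (trace x₀ i p).length = (coverComplex hA Q).graph.pathDegree p i := by
  induction p with
  | nil => rfl
  | cons p e ih =>
    simp only [trace, ColouredGraph.pathDegree, List.length_append, List.length_map, ih,
      Pi.add_apply]
    rw [add_comm]
    congr 1
    change _ = (Pi.single (CoverEdge.colour e.1) 1 : Fin k → ℕ) i
    by_cases h : CoverEdge.colour e.1 = i
    · subst h; simp
    · simp [h, Ne.symm h]

/-- In each tree a bicoloured path makes at most one step. Evaluating the label relation at `x₀ i`,
where the factor of the other colour is invisible, shows that this step is the same on both sides of
a square. -/
theorem trace_eq_of_coverSim (hfix : ∀ i, ∀ a ∈ A i, ∀ j, j ≠ i → a • x₀ j = x₀ j)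
    {a b b' c : (coverComplex hA Q).graph.Vertex} {x : a ⟶ b} {y : b ⟶ c} {y' : a ⟶ b'}
    {x' : b' ⟶ c} (h : CoverSim Q x.1 y.1 y'.1 x'.1) (i : Fin k) :
    trace x₀ i (x.toPath.comp y.toPath) = trace x₀ i (y'.toPath.comp x'.toPath) := by
  obtain ⟨⟨m, l, hl, n⟩, _⟩ := x
  obtain ⟨⟨m₁, l₁, hl₁, n₁⟩, _⟩ := y
  obtain ⟨⟨m₁', l₁', hl₁', n₁'⟩, _⟩ := y'
  obtain ⟨⟨m', l', hl', n'⟩, _⟩ := x'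
  obtain ⟨h1, -, -, h2, h3, -, h4⟩ := h
  dsimp only at h1 h2 h3 h4
  subst h2 h3
  change (if m₁' = i then [l₁ • x₀ i] else []) ++
      List.map (l₁ • ·) ((if m' = i then [l • x₀ i] else []) ++ []) =
    (if m' = i then [l' • x₀ i] else []) ++
      List.map (l' • ·) ((if m₁' = i then [l₁' • x₀ i] else []) ++ [])
  by_cases hi : m' = i
  · subst hi
    have := congrArg (· • x₀ m') h4
    simp only [mul_smul, hfix _ _ hl₁' _ h1] at this
    simp [Ne.symm h1, this]
  · by_cases hi' : m₁' = i
    · subst hi'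
      have := congrArg (· • x₀ m₁') h4
      simp only [mul_smul, hfix _ _ hl _ (Ne.symm h1)] at this
      simp [h1, this]
    · simp [hi, hi']

theorem label_trace_eq_of_ofPath_eq (hfix : ∀ i, ∀ a ∈ A i, ∀ j, j ≠ i → a • x₀ j = x₀ j)
    {a b : (coverComplex hA Q).graph.Vertex} {p q : Quiver.Path a b}
    (h : (coverDigraph hA Q).ofPath p = (coverDigraph hA Q).ofPath q) :
    pathLabel p = pathLabel q ∧ ∀ i, trace x₀ i p = trace x₀ i q := by
  have key := KDigraph.eq_of_ofPath_eq (coverDigraph hA Q) (β := G × ∀ i, List (T i))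
    -- The label must be carried along: by `trace_comp`, the trace of a composite involves the label
    -- of its later factor.
    (fun p => (pathLabel p, fun i => trace x₀ i p)) ?_ ?_ h
  · exact ⟨congrArg Prod.fst key, fun i => congrFun (congrArg Prod.snd key) i⟩
  · intro a b c d f p q g hpq
    have h1 : pathLabel p = pathLabel q := congrArg Prod.fst hpq
    have h2 : ∀ i, trace x₀ i p = trace x₀ i q := fun i => congrFun (congrArg Prod.snd hpq) i
    simp only [pathLabel_comp, trace_comp, h1, h2]
  · intro a b b' c x y y' x' hs
    have hs := coverDigraph_sim_iff.1 hs
    refine Prod.ext ?_ (funext fun i => trace_eq_of_coverSim x₀ hfix hs i)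
    simp only [pathLabel_comp]
    simpa [Quiver.Hom.toPath, pathLabel] using hs.label.symm

/-- A path is determined up to diversions by its terminus and its lift to the product of trees. -/
theorem ofPath_eq_of_trace_eq (hfix : ∀ i, ∀ a ∈ A i, ∀ j, j ≠ i → a • x₀ j = x₀ j)
    (hfree : ∀ g h : G, (∀ i, g • x₀ i = h • x₀ i) → g = h)
    {a a' b : (coverComplex hA Q).graph.Vertex} (p : Quiver.Path a b) (q : Quiver.Path a' b)
    (h : ∀ i, trace x₀ i p = trace x₀ i q) :
    (⟨a, (coverDigraph hA Q).ofPath p⟩ : Σ c, (coverDigraph hA Q).obj c ⟶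
      (coverDigraph hA Q).obj b) = ⟨a', (coverDigraph hA Q).ofPath q⟩ := by
  induction p with
  | nil =>
    cases q with
    | nil => rfl
    | cons q e =>
      have := h (CoverEdge.colour e.1)
      simp [trace] at this
  | @cons c b p e ih =>
    -- Equal traces have equal lengths, so `q` too has an edge of the colour of `e`, which can be
    -- moved to its end.
    have hq : (coverComplex hA Q).graph.pathDegree q (CoverEdge.colour e.1) ≠ 0 := by
      rw [← length_trace x₀, ← h]
      simp [trace]
    obtain ⟨c', q', e', he, hq'⟩ :=
      (coverDigraph hA Q).exists_cons_of_pathDegree_ne_zero q hq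
    have he : CoverEdge.colour e'.1 = CoverEdge.colour e.1 := he
    have ht := fun i => (h i).trans ((label_trace_eq_of_ofPath_eq x₀ hfix hq').2 i)
    -- The head of the trace in this colour is the image of the base point under the label of the
    -- last edge.
    have hl : CoverEdge.label e.1 = CoverEdge.label e'.1 := by
      refine IsCubeStructure.eq_of_smul_base_eq hfix hfree (CoverEdge.label_mem e.1)
        (he ▸ CoverEdge.label_mem e'.1) ?_
      have := ht (CoverEdge.colour e.1)
      simp only [trace, he, if_true, List.cons_append, List.cons.injEq] at this
      exact this.1
    have hE : e.1 = e'.1 := coverEdge_ext_of_target (Q := Q) he.symm hl (e.2.2.trans e'.2.2.symm)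
    rw [hq']
    clear hq hq' h
    obtain ⟨x, rfl, hx⟩ := e
    obtain ⟨x', hx', hx''⟩ := e'
    dsimp only at hE
    subst hE hx'
    have ht' : ∀ i, trace x₀ i p = trace x₀ i q' := by
      intro i
      have := List.append_cancel_left (ht i)
      exact (List.map_injective_iff.2 (MulAction.injective _)) this
    exact (coverDigraph hA Q).ofPath_cons_congr (ih q' ht') _

end Trace

/-! ### The `k`-graph of the cover -/

section Lambda

variable {G : Type u} [Group G] {k : ℕ} {A : Fin k → Set G} {N : ℕ}
  {hA : IsCubeStructure A} {Q : G →* Equiv.Perm (Fin N)}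

/-- The trace of the composite begins with that of the later factor, whose length is fixed by its
degree. Hence `q` and `q'` have equal traces and a common terminus, so they agree, and then `p` and
`p'` end at the same vertex. -/
theorem coverDigraph_factorisation_unique {a b b' c : (coverComplex hA Q).graph.Vertex}
    (p : Quiver.Path a b) (q : Quiver.Path b c) (p' : Quiver.Path a b') (q' : Quiver.Path b' c)
    (hd : (coverComplex hA Q).graph.pathDegree q = (coverComplex hA Q).graph.pathDegree q')
    (h : (coverDigraph hA Q).ofPath p ≫ (coverDigraph hA Q).ofPath q =
      (coverDigraph hA Q).ofPath p' ≫ (coverDigraph hA Q).ofPath q') :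
    (⟨b, (coverDigraph hA Q).ofPath p, (coverDigraph hA Q).ofPath q⟩ :
      Σ b, ((coverDigraph hA Q).obj a ⟶ (coverDigraph hA Q).obj b) ×
        ((coverDigraph hA Q).obj b ⟶ (coverDigraph hA Q).obj c)) =
      ⟨b', (coverDigraph hA Q).ofPath p', (coverDigraph hA Q).ofPath q'⟩ := by
  obtain ⟨T, _, x₀, hfix, hfree⟩ := hA.exists_base
  rw [← KDigraph.ofPath_comp, ← KDigraph.ofPath_comp] at h
  have ht := (label_trace_eq_of_ofPath_eq x₀ hfix h).2
  simp only [trace_comp] at ht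
  have ht' := fun i => List.append_inj (ht i) (by rw [length_trace, length_trace, hd])
  have hq := ofPath_eq_of_trace_eq x₀ hfix hfree q q' (fun i => (ht' i).1)
  simp only [Sigma.mk.injEq] at hq
  obtain ⟨rfl, hq⟩ := hq
  have hq := eq_of_heq hq
  -- The remaining halves are translates of the traces of `p` and `p'`; equal labels make it the
  -- same translation.
  have hl := (label_trace_eq_of_ofPath_eq x₀ hfix hq).1
  have hp := ofPath_eq_of_trace_eq x₀ hfix hfree p p' fun i => by
    have := (ht' i).2
    rw [← hl] at this
    exact List.map_injective_iff.2 (MulAction.injective _) this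
  rw [hq, eq_of_heq (Sigma.mk.inj hp).2]

theorem coverDigraph_isKGraph : IsKGraph (coverDigraph hA Q).degree where
  countable_obj := by
    have : Finite (coverComplex hA Q).graph.Vertex := (coverDigraph hA Q).finite_vertices
    exact Function.Surjective.countable (f := (coverDigraph hA Q).obj)
      (coverDigraph hA Q).obj_surjective
  countable_hom := (coverDigraph hA Q).countable_hom
  degree_id a := rfl
  degree_comp := (coverDigraph hA Q).degree_comp
  factorisation := by
    intro a c π m n hπ
    obtain ⟨a, rfl⟩ := (coverDigraph hA Q).obj_surjective a
    obtain ⟨c, rfl⟩ := (coverDigraph hA Q).obj_surjective c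
    obtain ⟨p, rfl⟩ := (coverDigraph hA Q).ofPath_surjective π
    obtain ⟨b, p₁, p₂, h1, h2, h3⟩ := (coverDigraph hA Q).exists_factorisation p m n hπ
    refine ⟨⟨(coverDigraph hA Q).obj b, (coverDigraph hA Q).ofPath p₁,
      (coverDigraph hA Q).ofPath p₂⟩, ⟨h1, h2, h3⟩, ?_⟩
    rintro ⟨b', f, g⟩ ⟨h1', h2', h3'⟩
    obtain ⟨b', rfl⟩ := (coverDigraph hA Q).obj_surjective b'
    obtain ⟨p₁', rfl⟩ := (coverDigraph hA Q).ofPath_surjective f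
    obtain ⟨p₂', rfl⟩ := (coverDigraph hA Q).ofPath_surjective g
    have := coverDigraph_factorisation_unique p₁' p₂' p₁ p₂ (h2'.trans h2.symm)
      (h1'.trans h1.symm)
    simp only [Sigma.mk.injEq] at this
    obtain ⟨rfl, this⟩ := this
    rw [eq_of_heq this]

/-- Commuting squares in `Λ` are no more than squares of the digraph, since the label is an
invariant of morphisms. This transfers the uniqueness in rigidity. -/
theorem coverSim_of_ofPath_eq {a b b' c : (coverComplex hA Q).graph.Vertex} {x : a ⟶ b}
    {y : b ⟶ c} {y' : a ⟶ b'} {x' : b' ⟶ c}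
    (hne : CoverEdge.colour x.1 ≠ CoverEdge.colour y.1)
    (hx : CoverEdge.colour x'.1 = CoverEdge.colour x.1)
    (hy : CoverEdge.colour y'.1 = CoverEdge.colour y.1)
    (h : (coverDigraph hA Q).ofPath x.toPath ≫ (coverDigraph hA Q).ofPath y.toPath =
      (coverDigraph hA Q).ofPath y'.toPath ≫ (coverDigraph hA Q).ofPath x'.toPath) :
    CoverSim Q x.1 y.1 y'.1 x'.1 := by
  obtain ⟨T, _, x₀, hfix, -⟩ := hA.exists_base
  rw [← KDigraph.ofPath_comp, ← KDigraph.ofPath_comp] at h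
  have hl := (label_trace_eq_of_ofPath_eq x₀ hfix h).1
  simp only [pathLabel_comp, Quiver.Hom.toPath, pathLabel, mul_one] at hl
  exact ⟨hne, x.2.2.trans y.2.1.symm, y'.2.2.trans x'.2.1.symm, hx, hy, y'.2.1.trans x.2.1.symm,
    hl.symm⟩

theorem coverDigraph_isRightRigidKGraph : IsRightRigidKGraph (coverDigraph hA Q).degree := by
  intro i j hij a b c x y hx hy
  obtain ⟨a, rfl⟩ := (coverDigraph hA Q).obj_surjective a
  obtain ⟨b, rfl⟩ := (coverDigraph hA Q).obj_surjective b
  obtain ⟨c, rfl⟩ := (coverDigraph hA Q).obj_surjective c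
  obtain ⟨⟨x, rfl, rfl⟩, rfl, rfl⟩ := (coverDigraph hA Q).exists_edge hx
  obtain ⟨⟨y, hyo, rfl⟩, rfl, rfl⟩ := (coverDigraph hA Q).exists_edge hy
  obtain ⟨⟨x', y'⟩, ⟨hx', hy', hs⟩, huniq⟩ := CoverSim.existsUnique_right Q hA hij hyo.symm
  refine ⟨⟨(coverDigraph hA Q).obj (CoverEdge.target Q x'), (coverDigraph hA Q).ofPath
    (Quiver.Hom.toPath ⟨x', hs.comp'.symm, rfl⟩), (coverDigraph hA Q).ofPath
    (Quiver.Hom.toPath ⟨y', hs.comp.symm, hs.terminus.symm⟩)⟩, ⟨?_, ?_, ?_⟩, ?_⟩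
  · exact ((coverDigraph hA Q).degree_edge _).trans (congrArg (Pi.single · 1) hx')
  · exact ((coverDigraph hA Q).degree_edge _).trans (congrArg (Pi.single · 1) hy')
  · exact (coverDigraph hA Q).ofPath_eq_of_sim (coverDigraph_sim_iff.2 hs)
  · rintro ⟨e, f, g⟩ ⟨hf, hg, hfg⟩
    obtain ⟨e, rfl⟩ := (coverDigraph hA Q).obj_surjective e
    obtain ⟨⟨f, hfo, rfl⟩, hf', rfl⟩ := (coverDigraph hA Q).exists_edge hf
    obtain ⟨⟨g, hgo, hgt⟩, hg', rfl⟩ := (coverDigraph hA Q).exists_edge hg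
    have := huniq (f, g) ⟨hf', hg', coverSim_of_ofPath_eq (hij.trans_eq hg'.symm) hf' hg'.symm hfg⟩
    obtain ⟨rfl, rfl⟩ := Prod.mk.inj this
    rfl

theorem coverDigraph_isLeftRigidKGraph : IsLeftRigidKGraph (coverDigraph hA Q).degree := by
  intro i j hij b c e x y hx hy
  obtain ⟨b, rfl⟩ := (coverDigraph hA Q).obj_surjective b
  obtain ⟨c, rfl⟩ := (coverDigraph hA Q).obj_surjective c
  obtain ⟨e, rfl⟩ := (coverDigraph hA Q).obj_surjective e
  obtain ⟨⟨x, rfl, rfl⟩, rfl, rfl⟩ := (coverDigraph hA Q).exists_edge hx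
  obtain ⟨⟨y, rfl, hyt⟩, rfl, rfl⟩ := (coverDigraph hA Q).exists_edge hy
  obtain ⟨⟨x', y'⟩, ⟨hx', hy', hs⟩, huniq⟩ := CoverSim.existsUnique_left Q hA hij hyt.symm
  refine ⟨⟨(coverDigraph hA Q).obj (CoverEdge.source x'), (coverDigraph hA Q).ofPath
    (Quiver.Hom.toPath ⟨x', rfl, hs.comp⟩), (coverDigraph hA Q).ofPath
    (Quiver.Hom.toPath ⟨y', hs.origin, hs.comp'⟩)⟩, ⟨?_, ?_, ?_⟩, ?_⟩
  · exact ((coverDigraph hA Q).degree_edge _).trans (congrArg (Pi.single · 1) hx')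
  · exact ((coverDigraph hA Q).degree_edge _).trans (congrArg (Pi.single · 1) hy')
  · exact (coverDigraph hA Q).ofPath_eq_of_sim (coverDigraph_sim_iff.2 hs)
  · rintro ⟨a, f, g⟩ ⟨hf, hg, hfg⟩
    obtain ⟨a, rfl⟩ := (coverDigraph hA Q).obj_surjective a
    obtain ⟨⟨f, rfl, hft⟩, hf', rfl⟩ := (coverDigraph hA Q).exists_edge hf
    obtain ⟨⟨g, hgo, hgt⟩, hg', rfl⟩ := (coverDigraph hA Q).exists_edge hg
    have := huniq (f, g) ⟨hf', hg', coverSim_of_ofPath_eq (hf'.trans_ne hij) hf'.symm hg' hfg⟩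
    obtain ⟨rfl, rfl⟩ := Prod.mk.inj this
    rfl

/-- Asking for paths in both directions makes the inverse step of the induction over generators
immediate; for a generator, the reversed edge leads back. -/
theorem nonempty_path_of_label (hA : IsCubeStructure A) (Q : G →* Equiv.Perm (Fin N)) (g : G) :
    ∀ a b : (coverComplex hA Q).graph.Vertex, Q g a = b →
      Nonempty (Quiver.Path a b) ∧ Nonempty (Quiver.Path b a) := by
  have hg : g ∈ Subgroup.closure (⋃ i, A i) := hA.closure_eq ▸ Subgroup.mem_top g
  induction hg using Subgroup.closure_induction with
  | mem g hg =>
    rintro a _ rfl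
    obtain ⟨i, hi⟩ := Set.mem_iUnion.1 hg
    let x : CoverEdge A N := ⟨i, g, hi, a⟩
    exact ⟨⟨Quiver.Hom.toPath ⟨x, rfl, rfl⟩⟩,
      ⟨Quiver.Hom.toPath ⟨x.reverse hA Q, rfl, CoverEdge.target_reverse hA Q x⟩⟩⟩
  | one =>
    rintro a _ rfl
    rw [map_one]
    exact ⟨⟨.nil⟩, ⟨.nil⟩⟩
  | mul g h _ _ ihg ihh =>
    rintro a _ rfl
    rw [map_mul]
    obtain ⟨⟨p⟩, ⟨p'⟩⟩ := ihh a _ rfl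
    obtain ⟨⟨q⟩, ⟨q'⟩⟩ := ihg (Q h a : Fin N) _ rfl
    exact ⟨⟨p.comp q⟩, ⟨q'.comp p'⟩⟩
  | inv g _ ih =>
    rintro a b h
    refine (ih b a ?_).symm
    rw [← h, map_inv]
    exact (Q g).apply_symm_apply a

/-- Left multiplication on the quotient group is transitive: lift the quotient of the two cosets to
`G`. -/
theorem exists_cayleyHom_eq {H : Subgroup G} [H.Normal] (e : G ⧸ H ≃ Fin N) (a b : Fin N) :
    ∃ g, cayleyHom H e g a = b := by
  obtain ⟨g, hg⟩ := QuotientGroup.mk_surjective (e.symm b * (e.symm a)⁻¹)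
  refine ⟨g, ?_⟩
  change e ((g : G ⧸ H) * e.symm a) = b
  rw [hg]
  simp

end Lambda
theorem theorem4p7 {G : Type u} [Group G] {k : ℕ} (hk : 2 ≤ k) (A : Fin k → Set G)
    (hA : IsCubeStructure A) (H : Subgroup G) [H.Normal] (N : ℕ) (e : G ⧸ H ≃ Fin N) :
    ∃ D : KDigraph (coverComplex hA (cayleyHom H e)).graph,
      (coverComplex hA (cayleyHom H e)).IsDG D ∧
      (D.LeftRigid ∧ D.RightRigid) ∧
      (IsKGraph D.degree ∧ IsStronglyConnectedKGraph D.degree ∧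
        IsLeftRigidKGraph D.degree ∧ IsRightRigidKGraph D.degree) := by
  refine ⟨coverDigraph hA (cayleyHom H e), coverDigraph_isDG,
    ⟨coverDigraph_leftRigid, coverDigraph_rightRigid⟩, coverDigraph_isKGraph,
    ⟨(coverDigraph hA (cayleyHom H e)).isFiniteKGraph, fun a b => ?_⟩,
    coverDigraph_isLeftRigidKGraph, coverDigraph_isRightRigidKGraph⟩
  obtain ⟨g, hg⟩ := exists_cayleyHom_eq e a.as b.as
  obtain ⟨⟨p⟩, -⟩ := nonempty_path_of_label hA (cayleyHom H e) g a.as b.as hg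
  exact ⟨(coverDigraph hA (cayleyHom H e)).ofPath p⟩
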